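/- Let $SG_2(n)$, $n\ge 0$, be the two-dimensional Sierpinski gasket graph at stage $n$: $SG_2(0)$ is a triangle (the complete graph on three vertices, all of them outmost), and $SG_2(n+1)$ is obtained from three copies of $SG_2(n)$, arranged at the corners of an equilateral triangle of twice the side length, by identifying, for each pair of copies, one outmost vertex of the one with one outmost vertex of the other (the point at which the two copies touch); the three outmost vertices of $SG_2(n+1)$ are the outmost vertices of the copies that have not been identified. Let $f_2(n)$ be the number of connected spanning subgraphs of $SG_2(n)$, that is, of connected subgraphs that contain all vertices of $SG_2(n)$, and let $v(SG_2(n))$ be the number of vertices of $SG_2(n)$. Then the asymptotic growth constant $$z_{SG_2}=\lim_{n\to\infty}\frac{\ln f_2(n)}{v(SG_2(n))}$$ exists, and $z_{SG_2}=1.276495930\ldots$, that is, $1.276495930\le z_{SG_2}<1.276495931$. -/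

import Mathlib

open Filter Topology

/-- The number of connected spanning subgraphs of a graph `G`: the number of subgraphs of `G`
that contain every vertex of `G` and are connected. -/
noncomputable def numConnectedSpanningSubgraphs {V : Type*} (G : SimpleGraph V) : ℕ :=
  {H : G.Subgraph | H.IsSpanning ∧ H.Connected}.ncard

/-- The translation by `a` on `ℕ × ℕ`, as a homomorphism of the complete graph on `ℕ × ℕ`. -/
def latticeShift (a : ℕ × ℕ) :
    (⊤ : SimpleGraph (ℕ × ℕ)) →g (⊤ : SimpleGraph (ℕ × ℕ)) where
  toFun p := p + a
  map_rel' := by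
    intro p q hpq
    simpa using hpq

/-- The two-dimensional Sierpinski gasket at stage `n`, drawn in the triangular lattice: the point
`(i, j)` stands for `i • u + j • v`, where `u` and `v` are two sides of a unit equilateral triangle
issuing from the same vertex. Stage `0` is the triangle with corners `(0, 0)`, `(1, 0)`, `(0, 1)`.
Stage `n` has the outmost vertices `(0, 0)`, `(2 ^ n, 0)`, `(0, 2 ^ n)`, and stage `n + 1` is the
union of three translates of stage `n`, any two of which share exactly one outmost vertex. -/
def sierpinskiGasket : ℕ → (⊤ : SimpleGraph (ℕ × ℕ)).Subgraph
  | 0 => (⊤ : (⊤ : SimpleGraph (ℕ × ℕ)).Subgraph).induce {(0, 0), (1, 0), (0, 1)}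
  | n + 1 =>
      sierpinskiGasket n ⊔
        (sierpinskiGasket n).map (latticeShift (2 ^ n, 0)) ⊔
        (sierpinskiGasket n).map (latticeShift (0, 2 ^ n))

/-- The graph sequence `G 0, G 1, G 2, …` has the asymptotic growth constant `z` for the number of
connected spanning subgraphs: `log N(G n) / |V(G n)|` tends to `z`. -/
def HasGrowthConstant {V : ℕ → Type*} (G : (n : ℕ) → SimpleGraph (V n)) (z : ℝ) : Prop :=
  Tendsto
    (fun n : ℕ => Real.log (numConnectedSpanningSubgraphs (G n) : ℝ) / (Nat.card (V n) : ℝ))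
    atTop (𝓝 z)

/-! Sort the subgraphs of stage n in which every vertex reaches a corner by the partition they
induce on the three corners. Let f, g, h be the numbers inducing the one-block partition, a given
two-block partition and the discrete one. Copies meet only at junctions and share no edge, so a
subgraph of stage n+1 is a triple of subgraphs of stage n, and its partition depends only on the
three partitions (`IsGluing.partitionCount_eq`). Enumerating the 125 triples gives a polynomial
recursion for (f, g, h), with f' = f³(1 + 6a) for a = g/f.

Put A = 1 + 6a and let G be the factor from one A to the next (`splitGrowth`). Then 2 log f + log A
is multiplied by 3 and increased by log G at each stage, so divided by 3ⁿ it changes only by log G /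
3ⁿ⁺¹. From b = h/f ≤ 5a² it follows that 1 ≤ G ≤ 2, hence `growthApprox` increases to a limit L with
error at most log 2 / (2·3ⁿ). Also log A = O(n), so log f / 3ⁿ tends to L/2; with v = 3(3ⁿ + 1)/2
the growth constant is L/3.

For the digits, a and b are enclosed in rational intervals through stage 17, and each log G is
bounded by an artanh series. This determines `growthApprox 18` up to about 10⁻¹⁰, and the tail
beyond it is below 10⁻⁹. -/

/-! ### Partitions of three corners -/

/-- The partitions of the three corners of a triangular network. -/
inductive CornerPartition
  | whole
  | isolate (k : Fin 3)
  | discrete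
  deriving DecidableEq, Fintype

namespace CornerPartition

/-- Whether two corners lie in the same block. -/
def rel : CornerPartition → Fin 3 → Fin 3 → Bool
  | whole, _, _ => true
  | isolate k, i, j => decide (i = j) || (decide (i ≠ k) && decide (j ≠ k))
  | discrete, i, j => decide (i = j)

/-- A list of pairs of corners which generates the partition. -/
def links : CornerPartition → List (Fin 3 × Fin 3)
  | whole => [(0, 1), (1, 2)]
  | isolate k => [(k + 1, k + 2)]
  | discrete => []

theorem rel_of_mem_links : ∀ (s : CornerPartition), ∀ p ∈ s.links, s.rel p.1 p.2 = true := by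
  decide

theorem rel_injective : ∀ s t : CornerPartition, (∀ i j, s.rel i j = t.rel i j) → s = t := by
  decide

theorem exists_rel_iff {r : Fin 3 → Fin 3 → Prop} (hr : Equivalence r) :
    ∃ s : CornerPartition, ∀ i j, r i j ↔ s.rel i j = true := by
  have hs : ∀ i j, r i j ↔ r j i := fun i j => ⟨hr.symm, hr.symm⟩
  have key : ∀ s : CornerPartition, (r 0 1 ↔ s.rel 0 1 = true) → (r 0 2 ↔ s.rel 0 2 = true) →
      (r 1 2 ↔ s.rel 1 2 = true) → ∀ i j, r i j ↔ s.rel i j = true := by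
    intro s h1 h2 h3
    have hsymm : ∀ (s : CornerPartition) (i j : Fin 3), s.rel i j = s.rel j i := by decide
    have hrefl : ∀ (s : CornerPartition) (i : Fin 3), s.rel i i = true := by decide
    have hd : ∀ i : Fin 3, r i i ↔ s.rel i i = true := fun i => by simp [hr.refl i, hrefl]
    intro i j
    fin_cases i <;> fin_cases j <;>
      first
        | exact hd _
        | assumption
        | (rw [hs, hsymm]; assumption)
  by_cases h1 : r 0 1 <;> by_cases h2 : r 0 2 <;> by_cases h3 : r 1 2
  · exact ⟨whole, key _ (by simp [h1, rel]) (by simp [h2, rel]) (by simp [h3, rel])⟩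
  · exact absurd (hr.trans (hr.symm h1) h2) h3
  · exact absurd (hr.trans h1 h3) h2
  · exact ⟨isolate 2, key _ (by simp [h1, rel]) (by simp [h2, rel]) (by simp [h3, rel])⟩
  · exact absurd (hr.trans h2 (hr.symm h3)) h1
  · exact ⟨isolate 1, key _ (by simp [h1, rel]) (by simp [h2, rel]) (by simp [h3, rel])⟩
  · exact ⟨isolate 0, key _ (by simp [h1, rel]) (by simp [h2, rel]) (by simp [h3, rel])⟩
  · exact ⟨discrete, key _ (by simp [h1, rel]) (by simp [h2, rel]) (by simp [h3, rel])⟩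

end CornerPartition

/-! ### Gluing three networks and the resulting corner partition -/

section Network

variable {V W : Type*}

/-- Every vertex of `S` is joined in `H` to a corner, and `H` induces the partition `s` on the
corners. -/
def InducesPartition (H : SimpleGraph V) (S : Set V) (c : Fin 3 → V) (s : CornerPartition) : Prop :=
  (∀ x ∈ S, ∃ k, H.Reachable x (c k)) ∧ ∀ i j, H.Reachable (c i) (c j) ↔ s.rel i j = true

/-- The number of subgraphs of `G` which induce the partition `s` on the corners. -/
noncomputable def partitionCount (G : SimpleGraph V) (S : Set V) (c : Fin 3 → V)
    (s : CornerPartition) : ℕ :=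
  Nat.card {H : SimpleGraph V // H ≤ G ∧ InducesPartition H S c s}

theorem InducesPartition.unique {H : SimpleGraph V} {S : Set V} {c : Fin 3 → V}
    {s t : CornerPartition} (hs : InducesPartition H S c s) (ht : InducesPartition H S c t) :
    s = t :=
  CornerPartition.rel_injective s t fun i j =>
    Bool.eq_iff_iff.2 ((hs.2 i j).symm.trans (ht.2 i j))

theorem exists_inducesPartition {H : SimpleGraph V} {S : Set V} {c : Fin 3 → V}
    (h : ∀ x ∈ S, ∃ k, H.Reachable x (c k)) : ∃ s, InducesPartition H S c s := by
  obtain ⟨s, hs⟩ := CornerPartition.exists_rel_iff (r := fun i j => H.Reachable (c i) (c j))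
    ⟨fun _ => .rfl, fun h => h.symm, fun h k => h.trans k⟩
  exact ⟨s, h, hs⟩

/-- The corners of three glued copies: `s(i, k)` is corner `k` of copy `i`, which is identified
with corner `i` of copy `k`. -/
abbrev Junction := Sym2 (Fin 3)

theorem Junction.exists_eq_mk (m : Junction) : ∃ i j, m = s(i, j) :=
  Sym2.ind (f := fun m => ∃ i j, m = s(i, j)) (fun i j => ⟨i, j, rfl⟩) m

/-- Merge the classes of `a` and `b` in a labelling. -/
def mergeLabel (lab : Junction → Junction) (p : Junction × Junction) : Junction → Junction :=
  fun m => if lab m = lab p.2 then lab p.1 else lab m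

/-- The pairs of junctions joined by copies with corner partitions `t`. -/
def junctionLinks (t : Fin 3 → CornerPartition) : List (Junction × Junction) :=
  (List.finRange 3).flatMap fun i => (t i).links.map fun p => (s(i, p.1), s(i, p.2))

/-- A labelling of the junctions by their classes in the union of three copies. -/
def junctionLabel (t : Fin 3 → CornerPartition) : Junction → Junction :=
  (junctionLinks t).foldl mergeLabel id

/-- Copies with corner partitions `t` form a network with the corner partition `s`. -/
def Assembles (t : Fin 3 → CornerPartition) (s : CornerPartition) : Prop :=
  (∀ m, ∃ k, junctionLabel t m = junctionLabel t s(k, k)) ∧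
    ∀ i j, junctionLabel t s(i, i) = junctionLabel t s(j, j) ↔ s.rel i j = true

instance (t : Fin 3 → CornerPartition) (s : CornerPartition) : Decidable (Assembles t s) := by
  unfold Assembles; infer_instance

/-- The labelling is coarse enough: `links` generates each partition, so every related pair gets
merged. There are only 125 triples of partitions, and the kernel checks them all. -/
theorem junctionLabel_eq_of_rel (t : Fin 3 → CornerPartition) (i k l : Fin 3)
    (h : (t i).rel k l = true) : junctionLabel t s(i, k) = junctionLabel t s(i, l) := by
  have key : ∀ s₀ s₁ s₂ : CornerPartition, ∀ i k l : Fin 3, (![s₀, s₁, s₂] i).rel k l = true →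
      junctionLabel ![s₀, s₁, s₂] s(i, k) = junctionLabel ![s₀, s₁, s₂] s(i, l) := by
    decide +kernel
  have ht : t = ![t 0, t 1, t 2] := by ext i; fin_cases i <;> rfl
  rw [ht] at h ⊢
  exact key _ _ _ _ _ _ h

/-- The labelling is no coarser than necessary: each merge joins two classes along a link already in
`r`, so "equal labels imply `r`" is an invariant of the fold. -/
theorem rel_of_junctionLabel_eq {r : Junction → Junction → Prop} (hr : Equivalence r)
    (t : Fin 3 → CornerPartition)
    (h : ∀ i k l, (t i).rel k l = true → r s(i, k) s(i, l)) {m n : Junction}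
    (hmn : junctionLabel t m = junctionLabel t n) : r m n := by
  have key : ∀ (L : List (Junction × Junction)) (lab : Junction → Junction),
      (∀ p ∈ L, r p.1 p.2) → (∀ m n, lab m = lab n → r m n) →
      ∀ m n, L.foldl mergeLabel lab m = L.foldl mergeLabel lab n → r m n := by
    intro L
    induction L with
    | nil => intro lab _ hlab; exact hlab
    | cons p L ih =>
      intro lab hL hlab
      rw [List.foldl_cons]
      refine ih _ (fun q hq => hL q (List.mem_cons_of_mem _ hq)) ?_
      have hp := hL p List.mem_cons_self
      intro m n hmn
      unfold mergeLabel at hmn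
      split_ifs at hmn with h1 h2 h2
      · exact hlab _ _ (h1.trans h2.symm)
      · exact hr.trans (hlab _ _ h1) (hr.trans (hr.symm hp) (hlab _ _ hmn))
      · exact hr.trans (hlab _ _ hmn) (hr.trans hp (hr.symm (hlab _ _ h2)))
      · exact hlab _ _ hmn
  refine key _ _ ?_ (fun m n h => by simp only [id] at h; exact h ▸ hr.refl _) m n hmn
  intro p hp
  simp only [junctionLinks, List.mem_flatMap, List.mem_map] at hp
  obtain ⟨i, -, q, hq, rfl⟩ := hp
  exact h _ _ _ (CornerPartition.rel_of_mem_links _ q hq)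

/-- Three networks `G i` on the vertex sets `S i` with corners `P s(i, k)` are glued to each other
at the junctions only. -/
structure IsGluing (G : Fin 3 → SimpleGraph V) (S : Fin 3 → Set V) (P : Junction → V) : Prop where
  injective : Function.Injective P
  mem_iff : ∀ i m, P m ∈ S i ↔ i ∈ m
  inter : ∀ {i j x}, i ≠ j → x ∈ S i → x ∈ S j → ∃ m, P m = x
  adj_mem : ∀ {i x y}, (G i).Adj x y → x ∈ S i

namespace IsGluing

variable {G H : Fin 3 → SimpleGraph V} {S : Fin 3 → Set V} {P : Junction → V}

theorem mono (hG : IsGluing G S P) (hH : ∀ i, H i ≤ G i) : IsGluing H S P :=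
  ⟨hG.injective, hG.mem_iff, hG.inter, fun h => hG.adj_mem (hH _ h)⟩

theorem inter' (hG : IsGluing G S P) {i j : Fin 3} {x : V} (hij : i ≠ j) (hi : x ∈ S i)
    (hj : x ∈ S j) : x = P s(i, j) := by
  obtain ⟨m, rfl⟩ := hG.inter hij hi hj
  rw [hG.mem_iff] at hi hj
  exact congrArg P ((Sym2.mem_and_mem_iff hij).1 ⟨hi, hj⟩)

/-- The invariant behind the description of reachability in a glued network. -/
theorem label_of_reachable (hH : IsGluing H S P) {r : Junction → Junction → Prop}
    (hr : Equivalence r)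
    (h : ∀ i k l, (H i).Reachable (P s(i, k)) (P s(i, l)) → r s(i, k) s(i, l))
    {x y : V} {m : Junction} (hxy : (⨆ i, H i).Reachable x y)
    (hx : ∃ i k, x ∈ S i ∧ (H i).Reachable x (P s(i, k)) ∧ r s(i, k) m) :
    ∃ i k, y ∈ S i ∧ (H i).Reachable y (P s(i, k)) ∧ r s(i, k) m := by
  rw [SimpleGraph.reachable_iff_reflTransGen] at hxy
  induction hxy with
  | refl => exact hx
  | @tail y z _ hyz ih =>
    obtain ⟨i, k, hyi, hyk, hkm⟩ := ih
    obtain ⟨j, hj⟩ := SimpleGraph.iSup_adj.1 hyz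
    have hyj := hH.adj_mem hj
    have hzj := hH.adj_mem hj.symm
    by_cases hij : i = j
    · subst hij
      exact ⟨i, k, hzj, hj.symm.reachable.trans hyk, hkm⟩
    -- A path can pass from copy i to copy j only through their common junction, which then serves
    -- as the new anchor.
    · have hy := hH.inter' hij hyi hyj
      refine ⟨j, i, hzj, ?_, ?_⟩
      · rw [Sym2.eq_swap, ← hy]; exact hj.symm.reachable
      · rw [Sym2.eq_swap]; exact hr.trans (h i j k (hy ▸ hyk)) hkm

theorem reachable_junction_iff (hH : IsGluing H S P) {t : Fin 3 → CornerPartition}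
    (ht : ∀ i, InducesPartition (H i) (S i) (fun k => P s(i, k)) (t i)) (m n : Junction) :
    (⨆ i, H i).Reachable (P m) (P n) ↔ junctionLabel t m = junctionLabel t n := by
  constructor
  · intro h
    have hr : Equivalence fun m n => junctionLabel t m = junctionLabel t n :=
      ⟨fun _ => rfl, fun h => h.symm, fun h k => h.trans k⟩
    have hrel : ∀ i k l, (H i).Reachable (P s(i, k)) (P s(i, l)) →
        junctionLabel t s(i, k) = junctionLabel t s(i, l) := fun i k l h =>
      junctionLabel_eq_of_rel t i k l (((ht i).2 k l).1 h)
    obtain ⟨i, k, rfl⟩ := Junction.exists_eq_mk n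
    obtain ⟨j, l, hm, hl, hlk⟩ := hH.label_of_reachable hr hrel (m := s(i, k)) h.symm
      ⟨i, k, (hH.mem_iff _ _).2 (Sym2.mem_mk_left _ _), .rfl, rfl⟩
    obtain ⟨a, rfl⟩ := (hH.mem_iff _ _).1 hm
    exact (hrel _ _ _ hl).trans hlk
  · refine rel_of_junctionLabel_eq (r := fun m n => (⨆ i, H i).Reachable (P m) (P n))
      ⟨fun _ => .rfl, fun h => h.symm, fun h k => h.trans k⟩ t fun i k l h => ?_
    exact (((ht i).2 k l).2 h).mono (le_iSup H i)

theorem inducesPartition_iff (hH : IsGluing H S P) {t : Fin 3 → CornerPartition}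
    (ht : ∀ i, InducesPartition (H i) (S i) (fun k => P s(i, k)) (t i)) (s : CornerPartition) :
    InducesPartition (⨆ i, H i) (⋃ i, S i) (fun k => P s(k, k)) s ↔ Assembles t s := by
  unfold InducesPartition Assembles
  simp only [hH.reachable_junction_iff ht]
  refine and_congr_left fun _ => ⟨fun h m => ?_, fun h x hx => ?_⟩
  · obtain ⟨i, j, rfl⟩ := Junction.exists_eq_mk m
    have hi : i ∈ s(i, j) := Sym2.mem_mk_left _ _
    obtain ⟨k, hk⟩ := h (P s(i, j)) (Set.mem_iUnion.2 ⟨i, (hH.mem_iff _ _).2 hi⟩)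
    exact ⟨k, (hH.reachable_junction_iff ht _ _).1 hk⟩
  · obtain ⟨i, hi⟩ := Set.mem_iUnion.1 hx
    obtain ⟨k, hk⟩ := (ht i).1 x hi
    obtain ⟨l, hl⟩ := h s(i, k)
    exact ⟨l, (hk.mono (le_iSup H i)).trans ((hH.reachable_junction_iff ht _ _).2 hl)⟩

/-- Follow a path from an outer corner to x, recording only that its current vertex is tied to some
junction within one copy (hence the trivial relation). If the final copy is not i, then x lies in
two copies and is itself a junction. -/
theorem exists_inducesPartition_component (hH : IsGluing H S P)
    (h : ∀ x ∈ ⋃ i, S i, ∃ k, (⨆ i, H i).Reachable x (P s(k, k))) (i : Fin 3) :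
    ∃ s, InducesPartition (H i) (S i) (fun k => P s(i, k)) s := by
  refine exists_inducesPartition fun x hx => ?_
  obtain ⟨k, hk⟩ := h x (Set.mem_iUnion.2 ⟨i, hx⟩)
  obtain ⟨j, l, hxj, hl, -⟩ := hH.label_of_reachable (r := fun _ _ => True) (m := s(i, i))
    ⟨fun _ => trivial, fun _ => trivial, fun _ _ => trivial⟩ (fun _ _ _ _ => trivial) hk.symm
    ⟨k, k, (hH.mem_iff _ _).2 (Sym2.mem_mk_left _ _), .rfl, trivial⟩
  by_cases hij : i = j
  · subst hij; exact ⟨l, hl⟩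
  · exact ⟨j, hH.inter' hij hx hxj ▸ .rfl⟩

/-- Two different copies have one common vertex, hence no common edge, so each piece can be
recovered from the union. -/
theorem iSup_inf_eq (hG : IsGluing G S P) (hH : ∀ i, H i ≤ G i) (i : Fin 3) :
    (⨆ j, H j) ⊓ G i = H i := by
  ext x y
  simp only [SimpleGraph.inf_adj, SimpleGraph.iSup_adj]
  refine ⟨fun ⟨⟨j, hj⟩, hi⟩ => ?_, fun h => ⟨⟨i, h⟩, hH i h⟩⟩
  by_cases hij : i = j
  · exact hij ▸ hj
  · have hx := hG.inter' hij (hG.adj_mem hi) (hG.adj_mem (hH j hj))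
    have hy := hG.inter' hij (hG.adj_mem hi.symm) (hG.adj_mem (hH j hj.symm))
    exact absurd (hx.trans hy.symm) hi.ne

/-- Taking unions is a bijection from admissible triples onto subgraphs: intersecting with each `G
i` inverts it, and the triple of partitions is determined by the pieces. -/
theorem partitionCount_eq (hG : IsGluing G S P)
    (hfin : ∀ i, Finite {K : SimpleGraph V // K ≤ G i}) (s : CornerPartition) :
    partitionCount (⨆ i, G i) (⋃ i, S i) (fun k => P s(k, k)) s =
      ∑ t : {t : Fin 3 → CornerPartition // Assembles t s},
        ∏ i, partitionCount (G i) (S i) (fun k => P s(i, k)) (t.1 i) := by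
  have hfin' : ∀ i u, Finite {K : SimpleGraph V // K ≤ G i ∧
      InducesPartition K (S i) (fun k => P s(i, k)) u} := fun i u =>
    Finite.of_injective (fun K => (⟨K.1, K.2.1⟩ : {K : SimpleGraph V // K ≤ G i}))
      fun K K' h => Subtype.ext (congrArg (fun K => K.1) h)
  unfold partitionCount
  simp_rw [← Nat.card_pi]
  rw [← Nat.card_sigma]
  let F : (Σ t : {t : Fin 3 → CornerPartition // Assembles t s}, ∀ i, {K : SimpleGraph V //
      K ≤ G i ∧ InducesPartition K (S i) (fun k => P s(i, k)) (t.1 i)}) →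
      {K : SimpleGraph V // K ≤ ⨆ i, G i ∧
        InducesPartition K (⋃ i, S i) (fun k => P s(k, k)) s} := fun K =>
    ⟨⨆ i, (K.2 i).1, iSup_mono fun i => (K.2 i).2.1,
      ((hG.mono fun i => (K.2 i).2.1).inducesPartition_iff (fun i => (K.2 i).2.2) s).2 K.1.2⟩
  symm
  refine Nat.card_congr (Equiv.ofBijective F ⟨?_, ?_⟩)
  · rintro ⟨⟨t, ht⟩, K⟩ ⟨⟨t', ht'⟩, K'⟩ h
    have hK : ∀ i, (K i).1 = (K' i).1 := fun i => by
      rw [← hG.iSup_inf_eq (fun i => (K i).2.1) i, ← hG.iSup_inf_eq (fun i => (K' i).2.1) i]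
      exact congrArg (· ⊓ G i) (congrArg Subtype.val h)
    obtain rfl : t = t' := funext fun i => (K i).2.2.unique (hK i ▸ (K' i).2.2)
    obtain rfl : K = K' := funext fun i => Subtype.ext (hK i)
    rfl
  · rintro ⟨K, hK, hKs⟩
    have hsup : ⨆ i, K ⊓ G i = K := by
      ext x y
      simp only [SimpleGraph.iSup_adj, SimpleGraph.inf_adj]
      refine ⟨fun ⟨_, h, _⟩ => h, fun h => ?_⟩
      obtain ⟨i, hi⟩ := SimpleGraph.iSup_adj.1 (hK h)
      exact ⟨i, h, hi⟩
    have hglue : IsGluing (fun i => K ⊓ G i) S P := hG.mono fun i => inf_le_right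
    rw [← hsup] at hKs
    choose t ht using hglue.exists_inducesPartition_component hKs.1
    exact ⟨⟨⟨t, (hglue.inducesPartition_iff ht s).1 hKs⟩,
      fun i => ⟨K ⊓ G i, inf_le_right, ht i⟩⟩, Subtype.ext hsup⟩

end IsGluing

end Network

/-! ### The polynomial recursion for the three counts -/

section Recursion

/-- The contribution of a copy with a given corner partition. -/
def CornerPartition.weight (f g h : ℕ) : CornerPartition → ℕ
  | .whole => f
  | .isolate _ => g
  | .discrete => h

/-- The numbers of copies that are whole, split in two, and split in three. -/
def partitionType (t : Fin 3 → CornerPartition) : ℕ × ℕ × ℕ :=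
  (∑ i, (t i).weight 1 0 0, ∑ i, (t i).weight 0 1 0, ∑ i, (t i).weight 0 0 1)

theorem prod_weight (f g h : ℕ) (t : Fin 3 → CornerPartition) :
    ∏ i, (t i).weight f g h =
      f ^ (partitionType t).1 * g ^ (partitionType t).2.1 * h ^ (partitionType t).2.2 := by
  simp only [partitionType, ← Finset.prod_pow_eq_pow_sum, ← Finset.prod_mul_distrib]
  refine Finset.prod_congr rfl fun i _ => ?_
  cases t i <;> simp [CornerPartition.weight]

/-- The weighted number of ways to assemble the corner partition `s`. -/
def assemblySum (f g h : ℕ) (s : CornerPartition) : ℕ :=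
  ∑ t : {t : Fin 3 → CornerPartition // Assembles t s}, ∏ i, (t.1 i).weight f g h

/-- Separates the combinatorics from the weights: the multiset of exponent triples does not involve
f, g, h, so the kernel can compute it by enumeration. -/
theorem assemblySum_eq (f g h : ℕ) (s : CornerPartition) :
    assemblySum f g h s =
      (((Finset.univ.filter fun t : CornerPartition × CornerPartition × CornerPartition =>
        Assembles ![t.1, t.2.1, t.2.2] s).val.map fun t => partitionType ![t.1, t.2.1, t.2.2]).map
          fun e => f ^ e.1 * g ^ e.2.1 * h ^ e.2.2).sum := by
  let e : (Fin 3 → CornerPartition) ≃ CornerPartition × CornerPartition × CornerPartition :=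
    { toFun := fun t => (t 0, t 1, t 2)
      invFun := fun t => ![t.1, t.2.1, t.2.2]
      left_inv := fun t => by ext i; fin_cases i <;> rfl
      right_inv := fun _ => rfl }
  rw [assemblySum, Multiset.map_map]
  change _ = ∑ t ∈ Finset.univ.filter _, _
  rw [← Finset.sum_subtype_eq_sum_filter, Finset.subtype_univ]
  refine Fintype.sum_equiv (e.subtypeEquiv fun t => ?_) _ _ fun t => ?_
  · change _ ↔ Assembles (e.symm (e t)) s
    rw [Equiv.symm_apply_apply]
  · rw [prod_weight]
    change _ = (fun u => f ^ (partitionType u).1 * g ^ (partitionType u).2.1 *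
      h ^ (partitionType u).2.2) (e.symm (e t.1))
    rw [Equiv.symm_apply_apply]

/-- At most one copy may be split, and only in two. It must not isolate its outer corner; either
junction may be isolated, since the neighbouring copy holds it. This gives 3 · 2 = 6 choices. -/
theorem assemblySum_whole (f g h : ℕ) :
    assemblySum f g h .whole = f ^ 3 + 6 * f ^ 2 * g := by
  rw [assemblySum_eq, show Multiset.map _ _ =
    Multiset.replicate 1 (3, 0, 0) + Multiset.replicate 6 (2, 1, 0) by decide +kernel]
  simp only [Multiset.map_add, Multiset.map_replicate, Multiset.sum_add, Multiset.sum_replicate,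
    smul_eq_mul]
  ring

theorem assemblySum_isolate (f g h : ℕ) (k : Fin 3) :
    assemblySum f g h (.isolate k) = f ^ 2 * g + 7 * f * g ^ 2 + f ^ 2 * h := by
  rw [assemblySum_eq, show Multiset.map _ _ = Multiset.replicate 1 (2, 1, 0) +
    Multiset.replicate 7 (1, 2, 0) + Multiset.replicate 1 (2, 0, 1) by
      revert k; decide +kernel]
  simp only [Multiset.map_add, Multiset.map_replicate, Multiset.sum_add, Multiset.sum_replicate,
    smul_eq_mul]
  ring

theorem assemblySum_discrete (f g h : ℕ) :
    assemblySum f g h .discrete = 3 * f * g ^ 2 + 14 * g ^ 3 + 12 * f * g * h := by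
  rw [assemblySum_eq, show Multiset.map _ _ = Multiset.replicate 3 (1, 2, 0) +
    Multiset.replicate 14 (0, 3, 0) + Multiset.replicate 12 (1, 1, 1) by decide +kernel]
  simp only [Multiset.map_add, Multiset.map_replicate, Multiset.sum_add, Multiset.sum_replicate,
    smul_eq_mul]
  ring

end Recursion

/-! ### Invariance under embeddings, connectedness, and the single triangle -/

section Transport

variable {V W : Type*}

theorem reachable_map_iff (f : V ↪ W) (H : SimpleGraph V) (x y : V) :
    (H.map f).Reachable (f x) (f y) ↔ H.Reachable x y := by
  refine ⟨fun h => ?_, fun h => h.map (SimpleGraph.Embedding.map f H).toHom⟩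
  have key : ∀ w, (H.map f).Reachable (f x) w → ∃ y, w = f y ∧ H.Reachable x y := by
    intro w hw
    rw [SimpleGraph.reachable_iff_reflTransGen] at hw
    induction hw with
    | refl => exact ⟨x, rfl, .rfl⟩
    | @tail v w _ hvw ih =>
      obtain ⟨y, rfl, hy⟩ := ih
      obtain ⟨u, z, huz, hu, rfl⟩ := (SimpleGraph.map_adj f H _ _).1 hvw
      exact ⟨z, rfl, hy.trans (f.injective hu ▸ huz.reachable)⟩
  obtain ⟨z, hz, hxz⟩ := key _ h
  exact f.injective hz ▸ hxz

theorem inducesPartition_map_iff (f : V ↪ W) (H : SimpleGraph V) (S : Set V) (c : Fin 3 → V)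
    (s : CornerPartition) :
    InducesPartition (H.map f) (f '' S) (fun k => f (c k)) s ↔ InducesPartition H S c s := by
  simp only [InducesPartition, Set.forall_mem_image, reachable_map_iff]

/-- A subgraph of the image has no edges outside the range of `f`, so pulling back and pushing
forward are inverse to each other. -/
theorem partitionCount_map (f : V ↪ W) (G : SimpleGraph V) (S : Set V) (c : Fin 3 → V)
    (s : CornerPartition) :
    partitionCount (G.map f) (f '' S) (fun k => f (c k)) s = partitionCount G S c s := by
  have hmap : ∀ K ≤ G.map f, (K.comap f).map f = K := by
    refine fun K hK => le_antisymm (SimpleGraph.map_comap_le f K) fun x y hxy => ?_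
    obtain ⟨u, v, -, rfl, rfl⟩ := (SimpleGraph.map_adj f G _ _).1 (hK hxy)
    exact (SimpleGraph.map_adj f _ _ _).2 ⟨u, v, hxy, rfl, rfl⟩
  symm
  refine Nat.card_congr
    { toFun := fun H => ⟨H.1.map f, SimpleGraph.map_monotone f H.2.1,
        (inducesPartition_map_iff f H.1 S c s).2 H.2.2⟩
      invFun := fun K => ⟨K.1.comap f,
        (SimpleGraph.comap_monotone f K.2.1).trans (SimpleGraph.comap_map_eq f G).le,
        (inducesPartition_map_iff f _ S c s).1 ((hmap K.1 K.2.1).symm ▸ K.2.2)⟩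
      left_inv := fun H => Subtype.ext (SimpleGraph.comap_map_eq f H.1)
      right_inv := fun K => Subtype.ext (hmap K.1 K.2.1) }

theorem inducesPartition_univ_whole_iff (H : SimpleGraph V) (c : Fin 3 → V) :
    InducesPartition H Set.univ c .whole ↔ H.Connected := by
  simp only [InducesPartition, CornerPartition.rel, Set.mem_univ, true_imp_iff, iff_true]
  constructor
  · rintro ⟨h, hc⟩
    refine (SimpleGraph.connected_iff H).2 ⟨fun x y => ?_, ⟨c 0⟩⟩
    obtain ⟨i, hi⟩ := h x
    obtain ⟨j, hj⟩ := h y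
    exact hi.trans ((hc i j).trans hj.symm)
  · exact fun h => ⟨fun x => ⟨0, h.preconnected x _⟩, fun i j => h.preconnected _ _⟩

theorem numConnectedSpanningSubgraphs_eq (G : SimpleGraph V) (c : Fin 3 → V) :
    numConnectedSpanningSubgraphs G = partitionCount G Set.univ c .whole := by
  refine Nat.card_congr
    { toFun := fun K => ⟨K.1.spanningCoe, K.1.spanningCoe_le,
        (inducesPartition_univ_whole_iff _ c).2
          ((K.1.spanningCoeEquivCoeOfSpanning K.2.1).connected_iff.2 K.2.2.coe)⟩
      invFun := fun H => ⟨SimpleGraph.toSubgraph H.1 H.2.1,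
        SimpleGraph.toSubgraph.isSpanning _ _, ?_⟩
      left_inv := fun K => Subtype.ext ?_
      right_inv := fun H => Subtype.ext ?_ }
  · refine ⟨((SimpleGraph.Subgraph.spanningCoeEquivCoeOfSpanning _
      (SimpleGraph.toSubgraph.isSpanning _ _)).connected_iff).1 ?_⟩
    exact (inducesPartition_univ_whole_iff _ c).1 H.2.2
  · exact SimpleGraph.Subgraph.ext (K.2.1.verts_eq_univ).symm rfl
  · rfl

/-- In a graph on three vertices any two vertices in the same component have distance at most
two. -/
theorem reachable_fin_three_iff (K : SimpleGraph (Fin 3)) (i j : Fin 3) :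
    K.Reachable i j ↔ i = j ∨ K.Adj i j ∨ ∃ k, K.Adj i k ∧ K.Adj k j := by
  constructor
  · intro h
    rw [SimpleGraph.reachable_iff_reflTransGen] at h
    induction h with
    | refl => exact Or.inl rfl
    | @tail j l _ hjl ih =>
      rcases ih with rfl | hij | ⟨k, hik, hkj⟩
      · exact Or.inr (Or.inl hjl)
      · exact Or.inr (Or.inr ⟨j, hij, hjl⟩)
      -- A path of length three would need four distinct vertices, so some coincidence shortens it.
      · have h1 := hik.ne
        have h2 := hkj.ne
        have h3 := hjl.ne
        by_cases hil : i = l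
        · exact Or.inl hil
        by_cases hkl : k = l
        · exact Or.inr (Or.inl (hkl ▸ hik))
        by_cases hij : i = j
        · exact Or.inr (Or.inl (hij ▸ hjl))
        omega
  · rintro (rfl | h | ⟨k, h, h'⟩)
    · exact .rfl
    · exact h.reachable
    · exact h.reachable.trans h'.reachable

/-- The three possible edges of a graph on three vertices. -/
def triangleEdge (b : Bool × Bool × Bool) (i j : Fin 3) : Bool :=
  (b.1 && decide (s(i, j) = s(0, 1))) || (b.2.1 && decide (s(i, j) = s(0, 2))) ||
    (b.2.2 && decide (s(i, j) = s(1, 2)))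

/-- The graphs on three vertices, encoded by their edges. -/
noncomputable def triangleSubgraphEquiv : SimpleGraph (Fin 3) ≃ Bool × Bool × Bool := by
  classical exact
  { toFun := fun K => (decide (K.Adj 0 1), decide (K.Adj 0 2), decide (K.Adj 1 2))
    invFun := fun b =>
      { Adj := fun i j => triangleEdge b i j = true
        symm := ⟨fun i j h => by revert b i j; decide⟩
        loopless := ⟨fun i h => by revert b i; decide⟩ }
    left_inv := fun K => by
      ext i j
      have h10 := K.adj_comm 1 0
      have h20 := K.adj_comm 2 0
      have h21 := K.adj_comm 2 1
      fin_cases i <;> fin_cases j <;> simp [triangleEdge, h10, h20, h21]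
    right_inv := fun b => by
      obtain ⟨a, b, c⟩ := b
      cases a <;> cases b <;> cases c <;> simp [triangleEdge] }

theorem partitionCount_triangle (s : CornerPartition) :
    partitionCount (⊤ : SimpleGraph (Fin 3)) Set.univ (fun k => k) s = s.weight 4 1 1 := by
  have h : partitionCount (⊤ : SimpleGraph (Fin 3)) Set.univ (fun k => k) s =
      Nat.card {b : Bool × Bool × Bool // ∀ i j, (i = j ∨ triangleEdge b i j = true ∨
        ∃ k, triangleEdge b i k = true ∧ triangleEdge b k j = true) ↔ s.rel i j = true} := by
    symm
    refine Nat.card_congr (triangleSubgraphEquiv.symm.subtypeEquiv fun b => ?_)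
    simp only [InducesPartition, le_top, true_and, Set.mem_univ, true_imp_iff,
      reachable_fin_three_iff]
    exact ⟨fun h => ⟨fun x => ⟨x, Or.inl rfl⟩, h⟩, fun h => h.2⟩
  rw [h, Nat.card_eq_fintype_card]
  clear h
  revert s
  decide +kernel

end Transport

/-! ### The gasket as a gluing of three translates -/

section Gasket

/-- The outmost vertices of the Sierpinski gasket at stage `n`. -/
def corner (n : ℕ) : Fin 3 → ℕ × ℕ := ![(0, 0), (2 ^ n, 0), (0, 2 ^ n)]

/-- The outmost vertices of the three copies of stage `n` in stage `n + 1`. -/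
def junctionPoint (n : ℕ) : Junction → ℕ × ℕ :=
  Sym2.lift ⟨fun i j => corner n i + corner n j, fun _ _ => add_comm _ _⟩

theorem junctionPoint_mk (n : ℕ) (i j : Fin 3) :
    junctionPoint n s(i, j) = corner n i + corner n j := rfl

theorem corner_succ (n : ℕ) : corner (n + 1) = fun k => junctionPoint n s(k, k) := by
  ext k <;> fin_cases k <;> simp [corner, junctionPoint_mk, pow_succ, mul_two]

theorem corner_injective (n : ℕ) : Function.Injective (corner n) := by
  have h : 0 < 2 ^ n := by positivity
  intro i j hij
  fin_cases i <;> fin_cases j <;> simp [corner] at hij ⊢ <;> omega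

theorem verts_succ (n : ℕ) : (sierpinskiGasket (n + 1)).verts =
    ⋃ i, addRightEmbedding (corner n i) '' (sierpinskiGasket n).verts := by
  ext x
  simp [sierpinskiGasket, latticeShift, Fin.exists_fin_succ, corner, or_assoc]
  simp only [← Prod.exists', exists_eq_right]

theorem spanningCoe_succ (n : ℕ) : (sierpinskiGasket (n + 1)).spanningCoe =
    ⨆ i, (sierpinskiGasket n).spanningCoe.map (addRightEmbedding (corner n i)) := by
  ext x y
  have h0 : ∀ v : ℕ × ℕ, v + (0, 0) = v := fun v => add_zero v
  simp [sierpinskiGasket, latticeShift, corner, h0, or_assoc, Relation.Map]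

theorem corner_mem_verts (n : ℕ) (k : Fin 3) : corner n k ∈ (sierpinskiGasket n).verts := by
  induction n with
  | zero => fin_cases k <;> simp [corner, sierpinskiGasket]
  | succ n ih =>
    rw [verts_succ, corner_succ]
    exact Set.mem_iUnion.2 ⟨k, corner n k, ih, rfl⟩

/-- Confines the stage to its big triangle, so that two translates can overlap only in the touching
corner. -/
theorem add_le_of_mem_verts (n : ℕ) :
    ∀ x ∈ (sierpinskiGasket n).verts, x.1 + x.2 ≤ 2 ^ n := by
  induction n with
  | zero => simp [sierpinskiGasket]
  | succ n ih =>
    intro x hx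
    rw [verts_succ] at hx
    obtain ⟨i, y, hy, rfl⟩ := Set.mem_iUnion.1 hx
    have := ih y hy
    rw [pow_succ]
    fin_cases i <;> simp [corner] <;> omega

theorem isGluing_gasket (n : ℕ) : IsGluing
    (fun i => (sierpinskiGasket n).spanningCoe.map (addRightEmbedding (corner n i)))
    (fun i => addRightEmbedding (corner n i) '' (sierpinskiGasket n).verts)
    (junctionPoint n) := by
  have hpos : 0 < 2 ^ n := by positivity
  have hinter : ∀ {i j x}, i ≠ j →
      x ∈ addRightEmbedding (corner n i) '' (sierpinskiGasket n).verts →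
      x ∈ addRightEmbedding (corner n j) '' (sierpinskiGasket n).verts →
      junctionPoint n s(i, j) = x := by
    rintro i j x hij ⟨⟨a, b⟩, hv, rfl⟩ ⟨⟨c, d⟩, hw, hvw⟩
    have h1 := add_le_of_mem_verts n _ hv
    have h2 := add_le_of_mem_verts n _ hw
    rw [junctionPoint_mk]
    fin_cases i <;> fin_cases j <;> simp [corner] at hij hvw h1 h2 ⊢ <;> omega
  refine ⟨fun m m' h => ?_, fun i m => ⟨fun h => ?_, fun h => ?_⟩,
    fun hij hi hj => ⟨_, hinter hij hi hj⟩, fun h => ?_⟩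
  · obtain ⟨i, j, rfl⟩ := Junction.exists_eq_mk m
    obtain ⟨k, l, rfl⟩ := Junction.exists_eq_mk m'
    rw [junctionPoint_mk, junctionPoint_mk] at h
    fin_cases i <;> fin_cases j <;> fin_cases k <;> fin_cases l <;>
      simp [corner] at h ⊢ <;> omega
  · obtain ⟨j, k, rfl⟩ := Junction.exists_eq_mk m
    obtain ⟨⟨a, b⟩, hv, h⟩ := h
    have h1 := add_le_of_mem_verts n _ hv
    rw [junctionPoint_mk] at h
    fin_cases i <;> fin_cases j <;> fin_cases k <;> simp [corner] at h h1 ⊢ <;> omega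
  · obtain ⟨j, rfl⟩ := Sym2.mem_iff_exists.1 h
    exact ⟨corner n j, corner_mem_verts n j, add_comm _ _⟩
  · obtain ⟨u, v, huv, rfl, -⟩ := (SimpleGraph.map_adj _ _ _ _).1 h
    exact ⟨u, (sierpinskiGasket n).edge_vert huv, rfl⟩

theorem finite_verts (n : ℕ) : (sierpinskiGasket n).verts.Finite := by
  induction n with
  | zero => simp [sierpinskiGasket]
  | succ n ih =>
    rw [verts_succ]
    exact Set.finite_iUnion fun i => ih.image _

/-- The ambient vertex type is infinite, but a subgraph is determined by its restriction to the
finitely many vertices of the copy. -/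
theorem finite_setOf_le_map (n : ℕ) (a : ℕ × ℕ) : Finite {K : SimpleGraph (ℕ × ℕ) //
    K ≤ (sierpinskiGasket n).spanningCoe.map (addRightEmbedding a)} := by
  let S := addRightEmbedding a '' (sierpinskiGasket n).verts
  have hS : Finite S := (finite_verts n).image _
  have hmem : ∀ {x y}, ((sierpinskiGasket n).spanningCoe.map (addRightEmbedding a)).Adj x y →
      x ∈ S := by
    intro x y h
    obtain ⟨u, v, huv, rfl, -⟩ := (SimpleGraph.map_adj _ _ _ _).1 h
    exact ⟨u, (sierpinskiGasket n).edge_vert huv, rfl⟩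
  refine Finite.of_injective (β := SimpleGraph S) (fun K => K.1.induce S) fun K K' h => ?_
  ext x y
  have hadj : ∀ (x y : S), K.1.Adj x y ↔ K'.1.Adj x y := fun x y =>
    iff_of_eq (congrArg (fun L : SimpleGraph S => L.Adj x y) h)
  exact ⟨fun hxy => (hadj ⟨x, hmem (K.2 hxy)⟩ ⟨y, hmem (K.2 hxy.symm)⟩).1 hxy,
    fun hxy => (hadj ⟨x, hmem (K'.2 hxy)⟩ ⟨y, hmem (K'.2 hxy.symm)⟩).2 hxy⟩

/-- The number of subgraphs of the gasket with a given corner partition. -/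
noncomputable def gasketCount (n : ℕ) (s : CornerPartition) : ℕ :=
  partitionCount (sierpinskiGasket n).spanningCoe (sierpinskiGasket n).verts (corner n) s

theorem numConnectedSpanningSubgraphs_gasket (n : ℕ) :
    numConnectedSpanningSubgraphs (sierpinskiGasket n).coe = gasketCount n .whole := by
  rw [numConnectedSpanningSubgraphs_eq _ fun k => ⟨corner n k, corner_mem_verts n k⟩,
    ← partitionCount_map (Function.Embedding.subtype _), gasketCount]
  congr 1
  · exact (sierpinskiGasket n).spanningCoe_coe
  · simp

theorem gasketCount_zero (s : CornerPartition) : gasketCount 0 s = s.weight 4 1 1 := by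
  rw [← partitionCount_triangle, ← partitionCount_map ⟨corner 0, corner_injective 0⟩, gasketCount]
  congr 1
  · ext x y
    rw [SimpleGraph.map_adj ⟨corner 0, corner_injective 0⟩]
    simp only [SimpleGraph.top_adj, Function.Embedding.coeFn_mk,
      sierpinskiGasket, SimpleGraph.Subgraph.spanningCoe_adj, SimpleGraph.Subgraph.induce_adj,
      SimpleGraph.Subgraph.top_adj]
    have hr : ∀ x : ℕ × ℕ, x ∈ ({(0, 0), (1, 0), (0, 1)} : Set (ℕ × ℕ)) ↔
        ∃ k, corner 0 k = x := by
      intro x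
      simp [Fin.exists_fin_succ, corner, eq_comm]
    rw [hr, hr]
    constructor
    · rintro ⟨⟨i, rfl⟩, ⟨j, rfl⟩, hij⟩
      exact ⟨i, j, fun h => hij (h ▸ rfl), rfl, rfl⟩
    · rintro ⟨i, j, hij, rfl, rfl⟩
      exact ⟨⟨i, rfl⟩, ⟨j, rfl⟩, (corner_injective 0).ne hij⟩
  · ext x
    simp only [Set.image_univ, Set.mem_range, Function.Embedding.coeFn_mk]
    simp [sierpinskiGasket, Fin.exists_fin_succ, corner, eq_comm]

theorem gasketCount_succ (n : ℕ) (s : CornerPartition) :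
    gasketCount (n + 1) s =
      ∑ t : {t : Fin 3 → CornerPartition // Assembles t s}, ∏ i, gasketCount n (t.1 i) := by
  rw [gasketCount, spanningCoe_succ, verts_succ, corner_succ,
    (isGluing_gasket n).partitionCount_eq fun i => finite_setOf_le_map n _]
  refine Finset.sum_congr rfl fun t _ => Finset.prod_congr rfl fun i _ => ?_
  rw [gasketCount, ← partitionCount_map (addRightEmbedding (corner n i)) _ _ (corner n)]
  congr 1
  exact funext fun k => add_comm (corner n i) (corner n k)

/-- The three counts at stage `n`, by recursion. -/
def countTriple : ℕ → ℕ × ℕ × ℕ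
  | 0 => (4, 1, 1)
  | n + 1 =>
    let (f, g, h) := countTriple n
    (f ^ 3 + 6 * f ^ 2 * g, f ^ 2 * g + 7 * f * g ^ 2 + f ^ 2 * h,
      3 * f * g ^ 2 + 14 * g ^ 3 + 12 * f * g * h)

theorem gasketCount_eq_weight (n : ℕ) (s : CornerPartition) :
    gasketCount n s =
      s.weight (countTriple n).1 (countTriple n).2.1 (countTriple n).2.2 := by
  induction n generalizing s with
  | zero => exact gasketCount_zero s
  | succ n ih =>
    rw [gasketCount_succ]
    simp_rw [ih]
    change assemblySum _ _ _ s = _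
    cases s with
    | whole => exact assemblySum_whole _ _ _
    | isolate k => exact assemblySum_isolate _ _ _ k
    | discrete => exact assemblySum_discrete _ _ _

/-- Inclusion–exclusion: three copies lose one vertex at each of three distinct junctions, so v
becomes 3v − 3. -/
theorem two_mul_card_verts (n : ℕ) :
    2 * Nat.card (sierpinskiGasket n).verts = 3 * (3 ^ n + 1) := by
  induction n with
  | zero =>
    change 2 * Set.ncard ({(0, 0), (1, 0), (0, 1)} : Set (ℕ × ℕ)) = _
    rw [Set.ncard_eq_three.2 ⟨(0, 0), (1, 0), (0, 1), by simp, by simp, by simp, rfl⟩]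
    norm_num
  | succ n ih =>
    change 2 * Set.ncard _ = _ at ih ⊢
    let S : Fin 3 → Set (ℕ × ℕ) := fun i =>
      addRightEmbedding (corner n i) '' (sierpinskiGasket n).verts
    have hfin : ∀ i, (S i).Finite := fun i => (finite_verts n).image _
    have hcard : ∀ i, (S i).ncard = (sierpinskiGasket n).verts.ncard := fun i =>
      Set.ncard_image_of_injective _ (addRightEmbedding _).injective
    have hG := isGluing_gasket n
    have hinter : ∀ i j, i ≠ j → S i ∩ S j = {junctionPoint n s(i, j)} := by
      intro i j hij
      ext x
      refine ⟨fun h => hG.inter' hij h.1 h.2, ?_⟩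
      rintro rfl
      exact ⟨(hG.mem_iff _ _).2 (Sym2.mem_mk_left _ _), (hG.mem_iff _ _).2 (Sym2.mem_mk_right _ _)⟩
    have hunion : (sierpinskiGasket (n + 1)).verts = S 0 ∪ S 1 ∪ S 2 := by
      rw [verts_succ]
      ext x
      simp [S, Fin.exists_fin_succ, or_assoc]
    have h1 := Set.ncard_union_add_ncard_inter (S 0) (S 1) (hfin 0) (hfin 1)
    have h2 := Set.ncard_union_add_ncard_inter (S 0 ∪ S 1) (S 2) ((hfin 0).union (hfin 1)) (hfin 2)
    rw [hinter 0 1 (by decide), Set.ncard_singleton] at h1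
    rw [Set.union_inter_distrib_right, hinter 0 2 (by decide), hinter 1 2 (by decide),
      Set.singleton_union, Set.ncard_pair (hG.injective.ne (by decide))] at h2
    rw [hcard] at h2
    rw [hcard, hcard] at h1
    rw [hunion, pow_succ]
    omega

end Gasket

/-! ### Ratios of the counts and existence of the limit -/

section Asymptotics

/-- The ratio of the counts of subgraphs in two pieces and of connected subgraphs. -/
noncomputable def splitRatio (n : ℕ) : ℝ := (countTriple n).2.1 / (countTriple n).1

/-- The ratio of the counts of subgraphs in three pieces and of connected subgraphs. -/
noncomputable def shatterRatio (n : ℕ) : ℝ := (countTriple n).2.2 / (countTriple n).1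

theorem countTriple_pos (n : ℕ) :
    0 < (countTriple n).1 ∧ 0 < (countTriple n).2.1 ∧ 0 < (countTriple n).2.2 := by
  induction n with
  | zero => decide
  | succ n ih =>
    obtain ⟨hf, hg, hh⟩ := ih
    simp only [countTriple]
    exact ⟨by positivity, by positivity, by positivity⟩

theorem splitRatio_pos (n : ℕ) : 0 < splitRatio n :=
  div_pos (Nat.cast_pos.2 (countTriple_pos n).2.1) (Nat.cast_pos.2 (countTriple_pos n).1)

theorem shatterRatio_pos (n : ℕ) : 0 < shatterRatio n :=
  div_pos (Nat.cast_pos.2 (countTriple_pos n).2.2) (Nat.cast_pos.2 (countTriple_pos n).1)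

theorem splitRatio_zero : splitRatio 0 = 1 / 4 := by norm_num [splitRatio, countTriple]

theorem shatterRatio_zero : shatterRatio 0 = 1 / 4 := by norm_num [shatterRatio, countTriple]

theorem countTriple_fst_succ (n : ℕ) : ((countTriple (n + 1)).1 : ℝ) =
    (countTriple n).1 ^ 3 * (1 + 6 * splitRatio n) := by
  have hf : ((countTriple n).1 : ℝ) ≠ 0 := Nat.cast_ne_zero.2 (countTriple_pos n).1.ne'
  simp only [splitRatio, countTriple]
  push_cast
  field_simp

theorem splitRatio_succ (n : ℕ) : splitRatio (n + 1) =
    (splitRatio n + 7 * splitRatio n ^ 2 + shatterRatio n) / (1 + 6 * splitRatio n) := by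
  have hf : (0 : ℝ) < (countTriple n).1 := Nat.cast_pos.2 (countTriple_pos n).1
  have hg : (0 : ℝ) < (countTriple n).2.1 := Nat.cast_pos.2 (countTriple_pos n).2.1
  simp only [splitRatio, shatterRatio, countTriple]
  push_cast
  field_simp

theorem shatterRatio_succ (n : ℕ) : shatterRatio (n + 1) =
    (3 * splitRatio n ^ 2 + 14 * splitRatio n ^ 3 + 12 * splitRatio n * shatterRatio n) /
      (1 + 6 * splitRatio n) := by
  have hf : (0 : ℝ) < (countTriple n).1 := Nat.cast_pos.2 (countTriple_pos n).1
  have hg : (0 : ℝ) < (countTriple n).2.1 := Nat.cast_pos.2 (countTriple_pos n).2.1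
  simp only [splitRatio, shatterRatio, countTriple]
  push_cast
  field_simp

/-- The constant 5 is what `splitGrowth_le_two` needs: 42a² + 6 · 5a² = 72a² is the quadratic term
of 2(1 + 6a)². -/
theorem shatterRatio_le (n : ℕ) : shatterRatio n ≤ 5 * splitRatio n ^ 2 := by
  induction n with
  | zero => norm_num [splitRatio_zero, shatterRatio_zero]
  | succ n ih =>
    have ha := splitRatio_pos n
    have hb := shatterRatio_pos n
    rw [splitRatio_succ, shatterRatio_succ, div_pow, ← mul_div_assoc,
      div_le_div_iff₀ (by positivity) (by positivity)]
    generalize splitRatio n = a at *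
    generalize shatterRatio n = b at *
    have h : (3 * a ^ 2 + 14 * a ^ 3 + 12 * a * b) * (1 + 6 * a) ≤
        5 * (a + 7 * a ^ 2 + b) ^ 2 := by
      nlinarith [mul_nonneg ha.le (sub_nonneg.2 ih), mul_pos ha hb, pow_pos ha 3, pow_pos ha 4,
        mul_pos (mul_pos ha ha) hb, pow_pos hb 2, pow_pos ha 2]
    calc _ = (3 * a ^ 2 + 14 * a ^ 3 + 12 * a * b) * (1 + 6 * a) * (1 + 6 * a) := by ring
      _ ≤ 5 * (a + 7 * a ^ 2 + b) ^ 2 * (1 + 6 * a) := by gcongr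

/-- The growth factor of `1 + 6 * splitRatio n`. -/
noncomputable def splitGrowth (n : ℕ) : ℝ :=
  (1 + 12 * splitRatio n + 42 * splitRatio n ^ 2 + 6 * shatterRatio n) /
    (1 + 6 * splitRatio n) ^ 2

theorem one_add_splitRatio_succ (n : ℕ) :
    1 + 6 * splitRatio (n + 1) = splitGrowth n * (1 + 6 * splitRatio n) := by
  have ha := splitRatio_pos n
  rw [splitRatio_succ, splitGrowth]
  field_simp
  ring

/-- Numerator minus denominator is 6a² + 6b. -/
theorem one_le_splitGrowth (n : ℕ) : 1 ≤ splitGrowth n := by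
  have ha := splitRatio_pos n
  have hb := shatterRatio_pos n
  rw [splitGrowth, one_le_div (by positivity)]
  nlinarith

theorem splitGrowth_le_two (n : ℕ) : splitGrowth n ≤ 2 := by
  have ha := splitRatio_pos n
  have hb := shatterRatio_le n
  rw [splitGrowth, div_le_iff₀ (by positivity)]
  nlinarith

/-- Growth of order 2ⁿ is harmless, since the logarithm is divided by 3ⁿ. -/
theorem one_add_splitRatio_le (n : ℕ) : 1 + 6 * splitRatio n ≤ 5 / 2 * 2 ^ n := by
  induction n with
  | zero => norm_num [splitRatio_zero]
  | succ n ih =>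
    have ha := splitRatio_pos n
    rw [one_add_splitRatio_succ, pow_succ]
    nlinarith [splitGrowth_le_two n]

/-- A sequence which increases to three times the growth constant. -/
noncomputable def growthApprox (n : ℕ) : ℝ :=
  (2 * Real.log (countTriple n).1 + Real.log (1 + 6 * splitRatio n)) / 3 ^ n

theorem growthApprox_zero : growthApprox 0 = Real.log 40 := by
  rw [growthApprox, splitRatio_zero, show (40 : ℝ) = 4 ^ 2 * (1 + 6 * (1 / 4)) by norm_num,
    Real.log_mul (by norm_num) (by norm_num), Real.log_pow]
  simp [countTriple]

theorem growthApprox_succ (n : ℕ) :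
    growthApprox (n + 1) = growthApprox n + Real.log (splitGrowth n) / 3 ^ (n + 1) := by
  have ha := splitRatio_pos n
  have hf : (0 : ℝ) < (countTriple n).1 := Nat.cast_pos.2 (countTriple_pos n).1
  have hr : 0 < splitGrowth n := zero_lt_one.trans_le (one_le_splitGrowth n)
  rw [growthApprox, growthApprox, countTriple_fst_succ, one_add_splitRatio_succ,
    Real.log_mul (by positivity) (by positivity), Real.log_mul (by positivity) (by positivity),
    Real.log_pow, pow_succ]
  push_cast
  field_simp
  ring

theorem growthApprox_monotone : Monotone growthApprox := by
  refine monotone_nat_of_le_succ fun n => ?_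
  rw [growthApprox_succ]
  have := Real.log_nonneg (one_le_splitGrowth n)
  exact le_add_of_nonneg_right (by positivity)

/-- The added term is the geometric tail of log 2 / 3ᵏ over k > n, an upper bound for all remaining
increments. -/
theorem growthApprox_add_antitone :
    Antitone fun n => growthApprox n + Real.log 2 / 2 / 3 ^ n := by
  refine antitone_nat_of_succ_le fun n => ?_
  have h : Real.log (splitGrowth n) / 3 ^ (n + 1) ≤ Real.log 2 / 3 ^ (n + 1) := by
    have := Real.log_le_log (zero_lt_one.trans_le (one_le_splitGrowth n)) (splitGrowth_le_two n)
    gcongr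
  have h2 : Real.log 2 / 2 / 3 ^ n =
      Real.log 2 / 3 ^ (n + 1) + Real.log 2 / 2 / 3 ^ (n + 1) := by
    rw [pow_succ]
    field_simp
    norm_num
  rw [growthApprox_succ]
  linarith

theorem exists_tendsto_growthApprox : ∃ L, Tendsto growthApprox atTop (𝓝 L) ∧
    ∀ n, growthApprox n ≤ L ∧ L ≤ growthApprox n + Real.log 2 / 2 / 3 ^ n := by
  have hlog : 0 ≤ Real.log 2 := Real.log_nonneg one_le_two
  have hle : ∀ m n, growthApprox m ≤ growthApprox n + Real.log 2 / 2 / 3 ^ n := fun m n =>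
    (growthApprox_monotone (le_max_left m n)).trans
      ((le_add_of_nonneg_right (by positivity)).trans
        (growthApprox_add_antitone (le_max_right m n)))
  have hbdd : BddAbove (Set.range growthApprox) :=
    ⟨_, Set.forall_mem_range.2 fun m => hle m 0⟩
  exact ⟨_, tendsto_atTop_ciSup growthApprox_monotone hbdd, fun n =>
    ⟨le_ciSup hbdd n, ciSup_le fun m => hle m n⟩⟩

theorem tendsto_log_countTriple_div {L : ℝ} (hL : Tendsto growthApprox atTop (𝓝 L)) :
    Tendsto (fun n => Real.log (countTriple n).1 / (3 * (3 ^ n + 1) / 2)) atTop (𝓝 (L / 3)) := by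
  have h0 : Tendsto (fun n => Real.log (1 + 6 * splitRatio n) / 3 ^ n) atTop (𝓝 0) := by
    have hlim : Tendsto (fun n : ℕ => 5 / 2 * (2 / 3 : ℝ) ^ n) atTop (𝓝 0) := by
      simpa using (tendsto_pow_atTop_nhds_zero_of_lt_one (by norm_num : (0 : ℝ) ≤ 2 / 3)
        (by norm_num)).const_mul (5 / 2)
    refine squeeze_zero (fun n => ?_) (fun n => ?_) hlim
    · have ha := splitRatio_pos n
      have := Real.log_nonneg (show 1 ≤ 1 + 6 * splitRatio n by linarith)
      positivity
    · have ha := splitRatio_pos n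
      rw [div_pow, ← mul_div_assoc]
      gcongr
      have := Real.log_le_sub_one_of_pos (show 0 < 1 + 6 * splitRatio n by linarith)
      linarith [one_add_splitRatio_le n]
  -- Without its correction term `growthApprox` is 2 log f / 3ⁿ; dividing by 1 + 3⁻ⁿ and by 3 gives
  -- exactly the required quotient.
  have h1 : Tendsto (fun n : ℕ => 1 + (1 / 3 : ℝ) ^ n) atTop (𝓝 (1 + 0)) :=
    (tendsto_pow_atTop_nhds_zero_of_lt_one (by norm_num) (by norm_num)).const_add 1
  have h2 := ((hL.sub h0).div h1 (by norm_num)).div_const 3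
  rw [sub_zero, add_zero, div_one] at h2
  refine h2.congr fun n => ?_
  simp only [Pi.div_apply, growthApprox, one_div, inv_pow]
  have : (0 : ℝ) < 3 ^ n := by positivity
  field_simp
  ring

end Asymptotics

/-! ### Certified interval arithmetic for the digits -/

section Numerics

/-- Partial sums of the Taylor series of `log ((1 + x) / (1 - x))`. -/
def logSeries {K : Type*} [Field K] (x : K) : K :=
  2 * (x + x ^ 3 / 3 + x ^ 5 / 5 + x ^ 7 / 7 + x ^ 9 / 9 + x ^ 11 / 11 + x ^ 13 / 13 +
    x ^ 15 / 15 + x ^ 17 / 17 + x ^ 19 / 19 + x ^ 21 / 21 + x ^ 23 / 23)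

theorem logSeries_eq (x : ℝ) :
    logSeries x = 2 * ∑ i ∈ Finset.range 12, x ^ (2 * i + 1) / (2 * i + 1) := by
  simp only [Finset.sum_range_succ, Finset.sum_range_zero, logSeries]
  push_cast
  norm_num

theorem logSeries_le_log {x r : ℝ} (h0 : 0 ≤ x) (h1 : x < 1) (h : (1 + x) / (1 - x) ≤ r) :
    logSeries x ≤ Real.log r := by
  have := Real.sum_range_le_log_div h0 h1 12
  have hlog := Real.log_le_log (div_pos (by linarith) (by linarith)) h
  rw [logSeries_eq]
  linarith

theorem log_le_logSeries {x r : ℝ} (hr : 0 < r) (h0 : 0 ≤ x) (h1 : x ≤ 1 / 2)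
    (h : r ≤ (1 + x) / (1 - x)) : Real.log r ≤ logSeries x + 8 / 3 * x ^ 25 := by
  have := Real.log_div_le_sum_range_add h0 (by linarith) 12
  have hlog := Real.log_le_log hr h
  -- For x ≤ 1/2 the factor 1/(1 − x²) is at most 4/3; doubling it gives the 8/3.
  have hx : x ^ 25 / (1 - x ^ 2) ≤ 4 / 3 * x ^ 25 := by
    rw [div_le_iff₀ (by nlinarith)]
    have : 0 ≤ x ^ 25 := by positivity
    nlinarith [mul_nonneg this (show 0 ≤ 1 / 4 - x ^ 2 by nlinarith)]
  rw [logSeries_eq]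
  norm_num at this ⊢
  linarith

/-- Bounds, in units of `10 ^ (-15)`, for `splitRatio n`, for `shatterRatio n`, and for the number
`x` with `splitGrowth n = (1 + x) / (1 - x)`. -/
structure RatioBox where
  /-- Lower bound for the split ratio. -/
  splitLo : ℕ
  /-- Upper bound for the split ratio. -/
  splitHi : ℕ
  /-- Lower bound for the shatter ratio. -/
  shatterLo : ℕ
  /-- Upper bound for the shatter ratio. -/
  shatterHi : ℕ
  /-- Lower bound for the parameter of the growth factor. -/
  paramLo : ℕ
  /-- Upper bound for the parameter of the growth factor. -/
  paramHi : ℕ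

namespace RatioBox

/-- The number `m * 10 ^ (-15)`. -/
def scale (m : ℕ) : ℚ := m / 10 ^ 15

/-- The box contains the ratios at stage `n`. -/
def Encloses (e : RatioBox) (n : ℕ) : Prop :=
  (scale e.splitLo : ℝ) ≤ splitRatio n ∧ splitRatio n ≤ scale e.splitHi ∧
    (scale e.shatterLo : ℝ) ≤ shatterRatio n ∧ shatterRatio n ≤ scale e.shatterHi

/-- The bounds of the box for the growth factor follow from those for the ratios. -/
def ParamOK (e : RatioBox) : Prop :=
  scale e.paramHi ≤ 1 / 2 ∧ scale e.paramLo ≤ 1 / 2 ∧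
  (1 + scale e.paramLo) * (1 + 6 * scale e.splitHi) ^ 2 ≤ (1 - scale e.paramLo) *
    (1 + 12 * scale e.splitLo + 42 * scale e.splitLo ^ 2 + 6 * scale e.shatterLo) ∧
  (1 - scale e.paramHi) *
    (1 + 12 * scale e.splitHi + 42 * scale e.splitHi ^ 2 + 6 * scale e.shatterHi) ≤
      (1 + scale e.paramHi) * (1 + 6 * scale e.splitLo) ^ 2

/-- The bounds for the ratios in `e'` follow from those in `e` one stage earlier. -/
def StepOK (e e' : RatioBox) : Prop :=
  scale e'.splitLo * (1 + 6 * scale e.splitHi) ≤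
    scale e.splitLo + 7 * scale e.splitLo ^ 2 + scale e.shatterLo ∧
  scale e.splitHi + 7 * scale e.splitHi ^ 2 + scale e.shatterHi ≤
    scale e'.splitHi * (1 + 6 * scale e.splitLo) ∧
  scale e'.shatterLo * (1 + 6 * scale e.splitHi) ≤
    3 * scale e.splitLo ^ 2 + 14 * scale e.splitLo ^ 3 +
      12 * scale e.splitLo * scale e.shatterLo ∧
  3 * scale e.splitHi ^ 2 + 14 * scale e.splitHi ^ 3 +
      12 * scale e.splitHi * scale e.shatterHi ≤
    scale e'.shatterHi * (1 + 6 * scale e.splitLo)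

instance (e : RatioBox) : Decidable e.ParamOK := by unfold ParamOK; infer_instance

instance (e e' : RatioBox) : Decidable (e.StepOK e') := by unfold StepOK; infer_instance

/-- All boxes of a list are consistent. -/
def Consistent : List RatioBox → Prop
  | [] => True
  | [e] => e.ParamOK
  | e :: e' :: l => e.ParamOK ∧ e.StepOK e' ∧ Consistent (e' :: l)

instance Consistent.decidable : (l : List RatioBox) → Decidable (Consistent l)
  | [] => instDecidableTrue
  | [e] => inferInstanceAs (Decidable e.ParamOK)
  | e :: e' :: l =>
    have := Consistent.decidable (e' :: l)
    inferInstanceAs (Decidable (e.ParamOK ∧ e.StepOK e' ∧ Consistent (e' :: l)))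

/-- A lower bound for the growth along a list of boxes. -/
def lowerSum : List RatioBox → ℚ
  | [] => 0
  | e :: l => (logSeries (scale e.paramLo) + lowerSum l) / 3

/-- An upper bound for the growth along a list of boxes. -/
def upperSum : List RatioBox → ℚ
  | [] => 0
  | e :: l => (logSeries (scale e.paramHi) + 8 / 3 * scale e.paramHi ^ 25 + upperSum l) / 3

theorem scale_nonneg (m : ℕ) : (0 : ℝ) ≤ scale m := by
  rw [Rat.cast_nonneg, scale]
  positivity

/-- Numerator and denominator of the growth factor both increase in the ratios, so opposite
endpoints bound the quotient on each side. -/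
theorem ParamOK.log_bounds {e : RatioBox} (h : e.ParamOK) {n : ℕ} (he : e.Encloses n) :
    logSeries (scale e.paramLo : ℝ) ≤ Real.log (splitGrowth n) ∧
      Real.log (splitGrowth n) ≤
        logSeries (scale e.paramHi : ℝ) + 8 / 3 * (scale e.paramHi : ℝ) ^ 25 := by
  obtain ⟨h1, h2, h3, h4⟩ := h
  obtain ⟨ha, ha', hb, hb'⟩ := he
  replace h1 : (scale e.paramHi : ℝ) ≤ 1 / 2 := by
    simpa using Rat.cast_le (K := ℝ).2 h1
  replace h2 : (scale e.paramLo : ℝ) ≤ 1 / 2 := by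
    simpa using Rat.cast_le (K := ℝ).2 h2
  replace h3 := Rat.cast_le (K := ℝ).2 h3
  replace h4 := Rat.cast_le (K := ℝ).2 h4
  push_cast at h3 h4
  have hx := scale_nonneg e.paramLo
  have hx' := scale_nonneg e.paramHi
  have h0 := scale_nonneg e.splitLo
  have h0' := splitRatio_pos n
  have hpos : 0 < splitGrowth n := zero_lt_one.trans_le (one_le_splitGrowth n)
  generalize (scale e.paramLo : ℝ) = x at *
  generalize (scale e.paramHi : ℝ) = x' at *
  refine ⟨logSeries_le_log hx (by linarith) ?_, log_le_logSeries hpos hx' h1 ?_⟩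
  · rw [splitGrowth, div_le_div_iff₀ (by linarith) (by positivity)]
    calc _ ≤ (1 + x) * (1 + 6 * (scale e.splitHi : ℝ)) ^ 2 := by gcongr
      _ ≤ _ := h3
      _ ≤ (1 - x) * (1 + 12 * splitRatio n + 42 * splitRatio n ^ 2 + 6 * shatterRatio n) := by
        have : 0 ≤ 1 - x := by linarith
        gcongr
      _ = _ := mul_comm _ _
  · rw [splitGrowth, div_le_div_iff₀ (by positivity) (by linarith)]
    calc _ = (1 - x') *
          (1 + 12 * splitRatio n + 42 * splitRatio n ^ 2 + 6 * shatterRatio n) := mul_comm _ _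
      _ ≤ (1 - x') * (1 + 12 * scale e.splitHi + 42 * scale e.splitHi ^ 2 +
          6 * scale e.shatterHi) := by
        have : 0 ≤ 1 - x' := by linarith
        gcongr
      _ ≤ _ := h4
      _ ≤ (1 + x') * (1 + 6 * splitRatio n) ^ 2 := by gcongr

theorem StepOK.encloses {e e' : RatioBox} (h : e.StepOK e') {n : ℕ} (he : e.Encloses n) :
    e'.Encloses (n + 1) := by
  obtain ⟨h1, h2, h3, h4⟩ := h
  obtain ⟨ha, ha', hb, hb'⟩ := he
  replace h1 := Rat.cast_le (K := ℝ).2 h1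
  replace h2 := Rat.cast_le (K := ℝ).2 h2
  replace h3 := Rat.cast_le (K := ℝ).2 h3
  replace h4 := Rat.cast_le (K := ℝ).2 h4
  push_cast at h1 h2 h3 h4
  have p1 := scale_nonneg e.splitLo
  have p2 := scale_nonneg e.shatterLo
  have q1 := scale_nonneg e'.splitLo
  have q2 := scale_nonneg e'.splitHi
  have q3 := scale_nonneg e'.shatterLo
  have q4 := scale_nonneg e'.shatterHi
  have p3 := scale_nonneg e.splitHi
  have h0 := splitRatio_pos n
  have h0' := shatterRatio_pos n
  rw [Encloses, splitRatio_succ, shatterRatio_succ, le_div_iff₀ (by positivity),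
    div_le_iff₀ (by positivity), le_div_iff₀ (by positivity), div_le_iff₀ (by positivity)]
  refine ⟨?_, ?_, ?_, ?_⟩
  · refine le_trans ?_ (h1.trans ?_) <;> gcongr
  · refine le_trans ?_ (h2.trans ?_) <;> gcongr
  · refine le_trans ?_ (h3.trans ?_) <;> gcongr
  · refine le_trans ?_ (h4.trans ?_) <;> gcongr

/-- Telescopes the increments log G / 3ᵏ⁺¹; the nested division by 3 in `lowerSum` and `upperSum` is
Horner's scheme for these weights. -/
theorem growthApprox_bounds : ∀ (l : List RatioBox) (e : RatioBox) (n : ℕ),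
    Consistent (e :: l) → e.Encloses n →
      growthApprox n + lowerSum (e :: l) / 3 ^ n ≤ growthApprox (n + (l.length + 1)) ∧
        growthApprox (n + (l.length + 1)) ≤ growthApprox n + upperSum (e :: l) / 3 ^ n := by
  have step : ∀ (e : RatioBox) (n : ℕ), e.ParamOK → e.Encloses n →
      growthApprox n + logSeries (scale e.paramLo : ℝ) / 3 ^ (n + 1) ≤ growthApprox (n + 1) ∧
      growthApprox (n + 1) ≤ growthApprox n +
        (logSeries (scale e.paramHi : ℝ) + 8 / 3 * (scale e.paramHi : ℝ) ^ 25) / 3 ^ (n + 1) := by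
    intro e n hp he
    obtain ⟨h1, h2⟩ := hp.log_bounds he
    rw [growthApprox_succ]
    constructor <;> gcongr
  have hcast : ∀ x : ℚ, ((logSeries x : ℚ) : ℝ) = logSeries (x : ℝ) := fun x => by
    simp only [logSeries]
    push_cast
    rfl
  intro l
  induction l with
  | nil =>
    intro e n hl he
    have := step e n hl he
    simp only [lowerSum, upperSum, add_zero, List.length_nil, zero_add]
    push_cast
    rw [hcast, hcast, div_div, div_div, ← pow_succ']
    exact this
  | cons e' l ih =>
    intro e n hl he
    obtain ⟨hp, hs, hl⟩ := hl
    have h1 := step e n hp he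
    have h2 := ih e' (n + 1) hl (hs.encloses he)
    rw [lowerSum, upperSum, List.length_cons, Rat.cast_div, Rat.cast_div, Rat.cast_add,
      Rat.cast_add, Rat.cast_add, hcast, hcast]
    push_cast
    rw [div_div, div_div, ← pow_succ', add_div, add_div _ (upperSum _ : ℝ)]
    rw [show n + (l.length + 1 + 1) = n + 1 + (l.length + 1) by ring]
    constructor <;> linarith [h1.1, h1.2, h2.1, h2.2]

/-- Bounds for the ratios at the first stages. -/
def initialBoxes : List RatioBox :=
  [⟨250000000000000, 250000000000000, 250000000000000, 250000000000000,
      130434782608695, 130434782608696⟩,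
    ⟨375000000000000, 375000000000000, 462500000000000, 462500000000000,
      146249052791108, 146249052791109⟩,
    ⟨560576923076923, 560576923076924, 997355769230769, 997355769230770,
      171267669137650, 171267669137654⟩,
    ⟨861164482828760, 861164482828765, 2318825435067056, 2318825435067068,
      194465208682364, 194465208682374⟩,
    ⟨1357424609967207, 1357424609967227, 5696217655332340, 5696217655332441,
      212882397844114, 212882397844139⟩,
    ⟨2181830530034215, 2181830530034300, 14580353244606577, 14580353244607286,
      226138673514032, 226138673514099⟩,
    ⟨3554391795564898, 3554391795565268, 38424032928177063, 38424032928182112,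
      235058320341671, 235058320341851⟩,
    ⟨5841273986155511, 5841273986157160, 103261910626454176, 103261910626490879,
      240799275038826, 240799275039318⟩,
    ⟨9652407738038850, 9652407738046305, 281040113830032283, 281040113830304634,
      244392657204217, 244392657205571⟩,
    ⟨16004145073405536, 16004145073439537, 770988170555118531, 770988170557168592,
      246603932376609, 246603932380346⟩,
    ⟨26590305358060470, 26590305358216378, 2125486535520823125, 2125486535536395745,
      247950893132456, 247950893142792⟩,
    ⟨44233874243562501, 44233874244279735, 5877200358469496669, 5877200358588456597,
      248766395536165, 248766395564788⟩,
    ⟨73639807250049469, 73639807253355524, 16280657692358529455, 16280657693270389953,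
      249258344428093, 249258344507411⟩,
    ⟨122649687978218928, 122649687993476145, 45149200011903481564, 45149200018907666248,
      249554468686795, 249554468906685⟩,
    ⟨204332818492329174, 204332818562790534, 125289677988739391394, 125289678042607314517,
      249732487244711, 249732487854450⟩,
    ⟨340471367062875532, 340471367388422232, 347818920996264313649, 347818921410864834517,
      249839421923598, 249839423614603⟩,
    ⟨567368946388918746, 567368947893402937, 965817046655397082272, 965817049847860718352,
      249903626198752, 249903630888859⟩,
    ⟨945531576135210699, 945531583089123367, 2682247400621519187110, 2682247425210475296164,
      249942161578635, 249942174587612⟩]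

theorem consistent_initialBoxes : Consistent initialBoxes := by decide +kernel

theorem lowerSum_initialBoxes : 1406083372 / 10 ^ 10 ≤ lowerSum initialBoxes := by
  decide +kernel

theorem upperSum_initialBoxes : upperSum initialBoxes ≤ 1406083373 / 10 ^ 10 := by
  decide +kernel

theorem growthApprox_eighteen_bounds :
    Real.log 40 + 1406083372 / 10 ^ 10 ≤ growthApprox 18 ∧
      growthApprox 18 ≤ Real.log 40 + 1406083373 / 10 ^ 10 := by
  have henc : Encloses (⟨250000000000000, 250000000000000, 250000000000000,
      250000000000000, 130434782608695, 130434782608696⟩ : RatioBox) 0 := by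
    norm_num [Encloses, splitRatio_zero, shatterRatio_zero, scale]
  have h := growthApprox_bounds initialBoxes.tail _ 0 consistent_initialBoxes henc
  have h1 := Rat.cast_le (K := ℝ).2 lowerSum_initialBoxes
  have h2 := Rat.cast_le (K := ℝ).2 upperSum_initialBoxes
  change _ + (lowerSum initialBoxes : ℝ) / _ ≤ growthApprox 18 ∧
    growthApprox 18 ≤ _ + (upperSum initialBoxes : ℝ) / _ at h
  rw [growthApprox_zero, pow_zero, div_one, div_one] at h
  push_cast at h1 h2
  exact ⟨(add_le_add_right h1 _).trans h.1, h.2.trans (add_le_add_right h2 _)⟩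

end RatioBox

/-- Writes 40 = 2⁵ · 5/4, where 2 and 5/4 are (1 + x)/(1 − x) for x = 1/3 and x = 1/9. -/
theorem log_forty_bounds :
    (3688879454113 / 10 ^ 12 : ℝ) ≤ Real.log 40 ∧ Real.log 40 ≤ 3688879454150 / 10 ^ 12 := by
  have h : Real.log 40 = 5 * Real.log 2 + Real.log (5 / 4) := by
    rw [show (40 : ℝ) = 2 ^ 5 * (5 / 4) by norm_num, Real.log_mul (by norm_num) (by norm_num),
      Real.log_pow]
    norm_num
  have h1 := logSeries_le_log (x := 1 / 3) (r := 2) (by norm_num) (by norm_num) (by norm_num)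
  have h2 := logSeries_le_log (x := 1 / 9) (r := 5 / 4) (by norm_num) (by norm_num) (by norm_num)
  have h3 := log_le_logSeries (x := 1 / 3) (r := 2) (by norm_num) (by norm_num) (by norm_num)
    (by norm_num)
  have h4 := log_le_logSeries (x := 1 / 9) (r := 5 / 4) (by norm_num) (by norm_num) (by norm_num)
    (by norm_num)
  norm_num [logSeries] at h1 h2 h3 h4
  rw [h]
  constructor <;> linarith

end Numerics

/-! ### The growth constant -/

theorem proposition1 :
    ∃ z : ℝ, HasGrowthConstant (fun n : ℕ => (sierpinskiGasket n).coe) z ∧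
      (1.276495930 : ℝ) ≤ z ∧ z < (1.276495931 : ℝ) := by
  obtain ⟨L, hL, hbounds⟩ := exists_tendsto_growthApprox
  refine ⟨L / 3, ?_, ?_⟩
  · refine (tendsto_log_countTriple_div hL).congr fun n => ?_
    rw [numConnectedSpanningSubgraphs_gasket, gasketCount_eq_weight]
    congr 1
    have h : (2 * Nat.card (sierpinskiGasket n).verts : ℝ) = 3 * (3 ^ n + 1) := by
      exact_mod_cast two_mul_card_verts n
    linarith
  -- The window for L = 3z has width 3 · 10⁻⁹, and the tail log 2 / (2 · 3¹⁸) is about 0.9 · 10⁻⁹.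
  · obtain ⟨h1, h2⟩ := hbounds 18
    obtain ⟨h3, h4⟩ := RatioBox.growthApprox_eighteen_bounds
    obtain ⟨h5, h6⟩ := log_forty_bounds
    have h7 := Real.log_two_lt_d9
    norm_num at *
    constructor <;> linarith
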